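/- Let $A=(a_1,\dots,a_n)$ be a configuration of points in $\mathbb R^d$, possibly repeated or affinely dependent, whose affine span is $\mathbb R^d$; put $v_i=(a_i,1)\in\mathbb R^{d+1}$ and $Z(V)=\sum_{i=1}^n[0,v_i]$. For disjoint $I,B\subseteq[n]$ with $|B|=d+1$ and $(a_b)_{b\in B}$ affinely independent, let $\Pi_{I,B}=\sum_{i\in I}v_i+\sum_{b\in B}[0,v_b]$; its order is $|I|$. Its faces are the sets $\Pi_{J,C}=\sum_{j\in J}v_j+\sum_{c\in C}[0,v_c]$ with $C\subseteq B$, $I\subseteq J\subseteq I\cup B$ and $J\cap C=\varnothing$. A fine zonotopal tiling $\mathcal P$ of $Z(V)$ is a set of such parallelepipeds (labelled by their pairs $(I,B)$) whose union is $Z(V)$ and any two of which are disjoint or meet in a common face $\Pi_{J,C}$ (with the same label $(J,C)$ in both). Given a choice of a set $\mathcal T_I$ of $(d+1)$-subsets of $[n]$ for each $I\subseteq[n]$, the following process is considered. Start with $\mathcal I^{(0)}=\{\varnothing\}$. In step $k=0,1,\dots,n-d-1$, build the tiles $\Pi_{I,B}$ with $I\in\mathcal I^{(k)}$ and $B\in\mathcal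 T_I$, and let $\mathcal I^{(k+1)}$ be the set of all $I\sqcup\{b\}$ such that $\Pi_{I,B}$ was built in step $k$, $b\in B$ and $\mathcal R(I\sqcup\{b\})\neq\varnothing$. Here, for $Q\subseteq[n]$, the link region $\mathcal R(Q)$ is the closure of the set of interior points of $\mathrm{conv}\{a_i:i\notin Q\}$ that do not lie in any simplex $\mathrm{conv}\{a_b:b\in B\}$ of a tile $\Pi_{I,B}$ built in a step $r<|Q|$ with $I\subseteq Q$ and $B\cap Q=\varnothing$. The process constructs $\mathcal P$ if for all $0\le k\le n-d-1$ the following holds: for every $I\in\mathcal I^{(k)}$, the simplices $\mathrm{conv}\{a_b:b\in B\}$, $B\in\mathcal T_I$, form a triangulation of $\mathcal R(I)$ by nondegenerate $d$-simplices with $B\cap I=\varnothing$ (their union is $\mathcal R(I)$, and any two of them, with vertex sets $B,B'$, meet exactly in $\mathrm{conv}\{a_b:b\in B\cap B'\}$); and the tiles built in step $k$ are exactly the tiles of order $k$ of $\mathcal P$. The spline functions of order $k$ built by the process are the multivariate (simplex) splines $M(\,\cdot\,|(a_i)_{i\in I\sqcup B})$, one for each tile $\Pi_{I,B}$ built in step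 $k$, where for $|X|=k+d+1$ the function $M(x|(a_i)_{i\in X})$ is $\frac{d!}{\det(X)}\mathbf 1_{\mathrm{conv}\{a_i:i\in X\}}(x)$ if $k=0$ and $\frac{k+d}{k}\sum_{b\in B}\frac{\det(B;\,b\to x)}{\det(B)}M(x|(a_i)_{i\in X\setminus\{b\}})$ if $k\ge1$, for some $B\subseteq X$ with $|B|=d+1$ and $(a_b)_{b\in B}$ affinely independent, and $M=0$ if there is no such $B$; here $\det(B)>0$ is the determinant of the suitably ordered rows $(a_b,1)$, $b\in B$, and $\det(B;\,b\to x)$ is obtained from it by replacing the row of $b$ by $(x,1)$ (different tiles count separately, even if their spline functions coincide). Then, for every fine zonotopal tiling $\mathcal P$ of $Z(V)$ and every choice of the $\mathcal T_I$ for which the process constructs $\mathcal P$, the total number of spline functions built, summed over all orders $k=0,\dots,n-d-1$, is equal to the number of sets $B\subseteq[n]$ with $|B|=d+1$ such that $(a_b)_{b\in B}$ is affinely independent. -/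

import Mathlib

namespace ZonotopalSplines

variable {n d : ℕ}

/-! Points live in `ℝ^d = Fin d → ℝ`; only its linear structure and its topology are used. A point
configuration is a family `a : Fin n → Fin d → ℝ` (points may be repeated), and "subsets of the
configuration" are sets of indices. -/

/-- The projective lift `(x, 1) ∈ ℝ^(d+1)` of a point `x ∈ ℝ^d`. -/
def lift (x : Fin d → ℝ) : Fin (d + 1) → ℝ := Fin.snoc (α := fun _ => ℝ) x 1

/-- The square matrix with rows `(a_i, 1)`, `i ∈ B`, where `|B| = d + 1`, in increasing order of the
indices. -/
noncomputable def rowMatrix (a : Fin n → Fin d → ℝ) (B : Finset (Fin n)) (h : B.card = d + 1) :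
    Matrix (Fin (d + 1)) (Fin (d + 1)) ℝ :=
  Matrix.of fun r => lift (a (B.orderEmbOfFin h r))

/-- `det(B)`: the determinant of the rows `(a_i, 1)`, `i ∈ B`, ordered so that it is nonnegative;
it is set to `0` when `B` does not have `d + 1` elements. -/
noncomputable def det (a : Fin n → Fin d → ℝ) (B : Finset (Fin n)) : ℝ :=
  if h : B.card = d + 1 then |(rowMatrix a B h).det| else 0

/-- The quotient `det(B; b → x) / det(B)`, where in the numerator the row of `b` is replaced by
`(x, 1)` (and the order of the rows is the same in both determinants). -/
noncomputable def detRatio (a : Fin n → Fin d → ℝ) (B : Finset (Fin n)) (b : Fin n)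
    (x : Fin d → ℝ) : ℝ :=
  if h : B.card = d + 1 then
    (rowMatrix (Function.update a b x) B h).det / (rowMatrix a B h).det
  else 0

/-- The convex hull of the points indexed by `X`. -/
def hull (a : Fin n → Fin d → ℝ) (X : Finset (Fin n)) : Set (Fin d → ℝ) :=
  convexHull ℝ (a '' (X : Set (Fin n)))

/-! ### Simplex splines -/

open Classical in
/-- The recursion defining the normalized multivariate spline of degree `k` on `k + d + 1` points:
`d! / det(X)` on the simplex for `k = 0`, and
`(k + d) / k * ∑_{b ∈ B} det(B; b → x) / det(B) * M(x | X \ {b})` for `k > 0`, where `B ⊆ X` is some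
affinely independent set of `d + 1` indices; the spline is `0` if there is no such `B`. -/
noncomputable def splineAux (a : Fin n → Fin d → ℝ) :
    ℕ → Finset (Fin n) → (Fin d → ℝ) → ℝ
  | 0, X, x =>
      if 0 < det a X then
        (d.factorial : ℝ) / det a X * (hull a X).indicator (fun _ => (1 : ℝ)) x
      else 0
  | k + 1, X, x =>
      if h : ∃ B ⊆ X, 0 < det a B then
        ((k + 1 + d : ℕ) : ℝ) / ((k + 1 : ℕ) : ℝ) *
          ∑ b ∈ h.choose, detRatio a h.choose b x * splineAux a k (X.erase b) x
      else 0

/-- The normalized multivariate spline `M(x | (a_i)_{i ∈ X})`, of degree `|X| - d - 1`. -/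
noncomputable def spline (a : Fin n → Fin d → ℝ) (X : Finset (Fin n)) : (Fin d → ℝ) → ℝ :=
  splineAux a (X.card - (d + 1)) X

/-! ### Zonotopes and fine zonotopal tilings -/

/-- The zonotope `Z(V) = ∑_i [0, v_i] ⊆ ℝ^(d+1)` with `v_i = (a_i, 1)`. -/
def zonotope (a : Fin n → Fin d → ℝ) : Set (Fin (d + 1) → ℝ) :=
  {z | ∃ α : Fin n → ℝ, (∀ i, 0 ≤ α i ∧ α i ≤ 1) ∧ z = ∑ i, α i • lift (a i)}

/-- `Π_{I,B} = ∑_{i ∈ I} v_i + ∑_{b ∈ B} [0, v_b]`. -/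
def parallelepiped (a : Fin n → Fin d → ℝ) (I B : Finset (Fin n)) : Set (Fin (d + 1) → ℝ) :=
  {z | ∃ α : Fin n → ℝ, (∀ b ∈ B, 0 ≤ α b ∧ α b ≤ 1) ∧
    z = ∑ i ∈ I, lift (a i) + ∑ b ∈ B, α b • lift (a b)}

/-- A (label of a) tile `Π_{I,B}` is the pair `(I, B)`. -/
abbrev Tile (n : ℕ) : Type := Finset (Fin n) × Finset (Fin n)

/-- `Π_{J,C}` is the face of `Π_{I,B}` obtained by setting the coefficients of the segments
`[0, v_b]`, `b ∈ B \ C`, to `1` if `b ∈ J` and to `0` if `b ∉ J`. -/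
def IsFace (J C I B : Finset (Fin n)) : Prop :=
  C ⊆ B ∧ I ⊆ J ∧ J ⊆ I ∪ B ∧ Disjoint J C

/-- A fine zonotopal tiling of `Z(V)`: a set of parallelepipeds `Π_{I,B}` with `I ∩ B = ∅`,
`|B| = d + 1` and `det(B) > 0`, which cover exactly `Z(V)` and any two of which either are disjoint
or meet in a common face. -/
structure IsFineZonotopalTiling (a : Fin n → Fin d → ℝ) (P : Finset (Tile n)) : Prop where
  disjoint : ∀ t ∈ P, Disjoint t.1 t.2
  card_eq : ∀ t ∈ P, t.2.card = d + 1
  det_pos : ∀ t ∈ P, 0 < det a t.2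
  cover : ⋃ t ∈ P, parallelepiped a t.1 t.2 = zonotope a
  inter : ∀ t ∈ P, ∀ t' ∈ P,
    (parallelepiped a t.1 t.2 ∩ parallelepiped a t'.1 t'.2).Nonempty →
    ∃ J C : Finset (Fin n), IsFace J C t.1 t.2 ∧ IsFace J C t'.1 t'.2 ∧
      parallelepiped a t.1 t.2 ∩ parallelepiped a t'.1 t'.2 = parallelepiped a J C

/-- The tiles of order `k`, i.e. with `|I| = k`. -/
def tilesOfOrder (P : Finset (Tile n)) (k : ℕ) : Finset (Tile n) :=
  P.filter fun t => t.1.card = k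

/-! ### Triangulations and link regions -/

/-- `T` is (the set of vertex sets of) a triangulation of the region `R`, by nondegenerate
`d`-simplices with vertices among the points with index outside `Q`: the simplices cover exactly `R`
and any two of them meet in their common, possibly empty, face. -/
structure IsTriangulation (a : Fin n → Fin d → ℝ) (Q : Finset (Fin n)) (R : Set (Fin d → ℝ))
    (T : Finset (Finset (Fin n))) : Prop where
  disjoint : ∀ B ∈ T, Disjoint B Q
  card_eq : ∀ B ∈ T, B.card = d + 1
  det_pos : ∀ B ∈ T, 0 < det a B
  cover : ⋃ B ∈ T, hull a B = R
  inter : ∀ B ∈ T, ∀ B' ∈ T, hull a B ∩ hull a B' = hull a (B ∩ B')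

/-- `E^(r)(Q)`: the union of the simplices `conv (a_b)_{b ∈ B}` over the tiles `Π_{I,B}` of order `r`
in `S` with `B ∩ Q = ∅` and `I ⊆ Q`. -/
def linkPart (a : Fin n → Fin d → ℝ) (S : Finset (Tile n)) (r : ℕ) (Q : Finset (Fin n)) :
    Set (Fin d → ℝ) :=
  ⋃ t ∈ (tilesOfOrder S r).filter (fun t => Disjoint t.2 Q ∧ t.1 ⊆ Q), hull a t.2

/-- The link region of `Q`, computed from the set `S` of tiles of order less than `|Q|`: it is
`conv (a_i)_{i ∉ Q}` minus the union of the `E^(r)(Q)`, `r < |Q|`. The difference is that of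
full-dimensional closed polyhedral regions, i.e. the closure of the set of interior points of
`conv (a_i)_{i ∉ Q}` that are outside all `E^(r)(Q)`. -/
def linkRegion (a : Fin n → Fin d → ℝ) (S : Finset (Tile n)) (Q : Finset (Fin n)) :
    Set (Fin d → ℝ) :=
  closure (interior (hull a Qᶜ) \ ⋃ r ∈ Finset.range Q.card, linkPart a S r Q)

/-! ### The iterative construction -/

/-- The data available at the beginning of step `k` of the construction: the tiles of all orders
less than `k`, and the family `𝓘^(k)` of index sets to be treated in step `k`. -/
structure State (n : ℕ) where
  lower : Finset (Tile n)
  sets : Finset (Finset (Fin n))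

/-- The tiles `Π_{I,B}`, `I ∈ 𝓘^(k)`, `B ∈ 𝓣_I`, built in one step with the triangulations
`𝓣_I = T I`. -/
def State.newTiles (s : State n) (T : Finset (Fin n) → Finset (Finset (Fin n))) :
    Finset (Tile n) :=
  s.sets.biUnion fun I => (T I).image fun B => (I, B)

open Classical in
/-- The construction with the triangulations `T`: `𝓘^(0) = {∅}`, and `𝓘^(k+1)` consists of the sets
`I ⊔ {b}` with nonempty link region, for the tiles `Π_{I,B}` built in step `k` and `b ∈ B`. -/
noncomputable def state (a : Fin n → Fin d → ℝ) (T : Finset (Fin n) → Finset (Finset (Fin n))) :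
    ℕ → State n
  | 0 => { lower := ∅, sets := {∅} }
  | k + 1 =>
    { lower := (state a T k).lower ∪ (state a T k).newTiles T
      sets := (((state a T k).newTiles T).biUnion fun t => t.2.image fun b => insert b t.1).filter
        fun Q => (linkRegion a ((state a T k).lower ∪ (state a T k).newTiles T) Q).Nonempty }

/-- The tiles built in step `k` of the construction. -/
noncomputable def builtTiles (a : Fin n → Fin d → ℝ)
    (T : Finset (Fin n) → Finset (Finset (Fin n))) (k : ℕ) : Finset (Tile n) :=
  (state a T k).newTiles T

/-- The construction with the choice `T` builds the tiling `P`: in each step `0 ≤ k ≤ n - d - 1`,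
for every `I ∈ 𝓘^(k)` the chosen `T I` is a triangulation of the link region of `I`, and the tiles
built are the tiles of order `k` of `P`. -/
structure Constructs (a : Fin n → Fin d → ℝ) (T : Finset (Fin n) → Finset (Finset (Fin n)))
    (P : Finset (Tile n)) : Prop where
  triangulation : ∀ k < n - d, ∀ I ∈ (state a T k).sets,
    IsTriangulation a I (linkRegion a (state a T k).lower I) (T I)
  built : ∀ k < n - d, builtTiles a T k = tilesOfOrder P k

/-- The family of spline functions of order `k` built by the construction: one spline
`M(· | (a_i)_{i ∈ I ⊔ B})` for each tile `Π_{I,B}` built in step `k`. It is a multiset, because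
different tiles can have the same spline. -/
noncomputable def builtSplines (a : Fin n → Fin d → ℝ)
    (T : Finset (Fin n) → Finset (Finset (Fin n))) (k : ℕ) : Multiset ((Fin d → ℝ) → ℝ) :=
  (builtTiles a T k).val.map fun t => spline a (t.1 ∪ t.2)

end ZonotopalSplines

/-! The tiles built in step `k` are the tiles of order `k` of `P`, and each contributes one spline,
so the total is the number of tiles. It remains to see that every basis `B` labels exactly one tile.

Lifted to faces of the cube `[0,1]^n`, the tiles form a section of the projection onto the zonotope
(`IsCubicalSection`): two tiles meet in a face with the same label in both, so a point of `Z(V)` has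
only one lift. In coordinates where `B` is the standard basis, let `N k` be the number of cells
parallel to the first `k` basis vectors in the face of the zonotope that is lexicographically
maximal in the coordinates from `k` on. Then `N 0 = 1`, the extreme vertex, and `N m`, with `m =
|B|`, counts the tiles labelled by `B`.

The heart is `N (j + 1) = N j` (`card_extremeCells_succ`). Cells parallel to the first `j` basis
vectors are stacked in direction `j` and separated by crossing cells, which have one more generator.
Each facet that is not topmost is the lower facet of exactly one crossing cell (`exists_lowerFacet`,
`lowerFacet_injOn`), and likewise downwards. Counting facets with `b j ∈ J` in both ways, the
crossing cells generated by `b j` itself are exactly as many as the topmost facets. -/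

namespace ZonotopalSplines

/-! ### Lexicographic extremality in a vector configuration -/

section Core

variable {n m : ℕ}

open Finset Filter Topology

/-- The points `σ` of the face of the cube `[0,1]^n` whose coordinates in `I` are `1`, whose
coordinates in `B` are free, and whose other coordinates are `0`. -/
def OnFace (I B : Finset (Fin n)) (σ : Fin n → ℝ) : Prop :=
  (∀ i, 0 ≤ σ i ∧ σ i ≤ 1) ∧ (∀ i ∈ I, σ i = 1) ∧ ∀ i, i ∉ I → i ∉ B → σ i = 0

lemma OnFace.of_isFace {J C I B : Finset (Fin n)} {σ : Fin n → ℝ} (h : IsFace J C I B)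
    (hσ : OnFace J C σ) : OnFace I B σ := by
  obtain ⟨hC, hI, hJ, -⟩ := h
  refine ⟨hσ.1, fun i hi => hσ.2.1 i (hI hi), fun i hi hi' => hσ.2.2 i (fun h => ?_) fun h => ?_⟩
  · rcases Finset.mem_union.1 (hJ h) with h | h <;> contradiction
  · exact hi' (hC h)

/-- The projection of the cube along the configuration `v`. -/
def comb (v : Fin n → Fin m → ℝ) (σ : Fin n → ℝ) : Fin m → ℝ := ∑ i, σ i • v i

lemma comb_apply (v : Fin n → Fin m → ℝ) (σ : Fin n → ℝ) (j : Fin m) :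
    comb v σ j = ∑ i, σ i * v i j := by
  simp [comb, Finset.sum_apply]

lemma comb_add (v : Fin n → Fin m → ℝ) (σ τ : Fin n → ℝ) :
    comb v (σ + τ) = comb v σ + comb v τ := by
  simp [comb, add_smul, Finset.sum_add_distrib]

lemma comb_smul (v : Fin n → Fin m → ℝ) (c : ℝ) (σ : Fin n → ℝ) :
    comb v (c • σ) = c • comb v σ := by
  simp [comb, mul_smul, Finset.smul_sum]

lemma comb_single (v : Fin n → Fin m → ℝ) (i : Fin n) (c : ℝ) :
    comb v (Pi.single i c) = c • v i := by
  rw [comb, Finset.sum_eq_single i] <;> simp +contextual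

lemma continuous_comb (v : Fin n → Fin m → ℝ) : Continuous (comb v) := by
  unfold comb; fun_prop

lemma isCompact_onFace (I B : Finset (Fin n)) : IsCompact {σ | OnFace I B σ} := by
  have h1 : IsCompact (Set.Icc (0 : Fin n → ℝ) 1) := isCompact_Icc
  refine h1.of_isClosed_subset ?_ fun σ hσ => ⟨fun i => (hσ.1 i).1, fun i => (hσ.1 i).2⟩
  simp only [OnFace, Set.ofPred_and, Set.ofPred_forall]
  refine IsClosed.inter ?_ (IsClosed.inter ?_ ?_)
  · exact isClosed_iInter fun i =>
      (isClosed_le continuous_const (continuous_apply i)).inter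
        (isClosed_le (continuous_apply i) continuous_const)
  · exact isClosed_biInter fun i _ => isClosed_eq (continuous_apply i) continuous_const
  · exact isClosed_iInter fun i => isClosed_iInter fun _ => isClosed_iInter fun _ =>
      isClosed_eq (continuous_apply i) continuous_const

/-- The vector `v i` lies in the span of the first `k` coordinate vectors. -/
def InFlat (v : Fin n → Fin m → ℝ) (k : ℕ) (i : Fin n) : Prop :=
  ∀ j : Fin m, k ≤ j → v i j = 0

/-- The last nonzero coordinate of `v i` is positive. -/
def LexPos (v : Fin n → Fin m → ℝ) (i : Fin n) : Prop :=
  ∃ j, 0 < v i j ∧ ∀ j', j < j' → v i j' = 0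

/-- `J` selects exactly the lexicographically positive vectors among those outside the span of the
first `k` coordinate vectors. -/
def LexTop (v : Fin n → Fin m → ℝ) (k : ℕ) (J : Finset (Fin n)) : Prop :=
  ∀ i, ¬ InFlat v k i → (i ∈ J ↔ LexPos v i)

lemma lexPos_iff {v : Fin n → Fin m → ℝ} {i : Fin n} {j : Fin m} (hi : InFlat v (j + 1) i)
    (hj : v i j ≠ 0) : LexPos v i ↔ 0 < v i j := by
  constructor
  · rintro ⟨l, hl, hl'⟩
    have h1 : ¬ j < l := fun h => hl.ne' (hi l h)
    have h2 : ¬ l < j := fun h => hj (hl' j h)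
    rwa [le_antisymm (not_lt.1 h2) (not_lt.1 h1)]
  · exact fun h => ⟨j, h, fun j' hj' => hi j' hj'⟩

/-- A point of the cube whose projection agrees with that of a lexicographically extreme point modulo
the span of the first `k` coordinate vectors has the same extreme coordinates. -/
lemma eq_of_lexTop {v : Fin n → Fin m → ℝ} {k : ℕ} {σ τ : Fin n → ℝ} {J : Finset (Fin n)}
    (hσ : ∀ i, 0 ≤ σ i ∧ σ i ≤ 1) (hJ : LexTop v k J)
    (hτ : ∀ i, ¬ InFlat v k i → τ i = if i ∈ J then 1 else 0)
    (h : ∀ j : Fin m, k ≤ j → comb v σ j = comb v τ j) (i : Fin n) (hi : ¬ InFlat v k i) :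
    σ i = τ i := by
  have key : ∀ j : Fin m, k ≤ j → ∀ i, v i j ≠ 0 → σ i = τ i := by
    intro j
    -- Induction from the highest coordinate downwards, in the order of lexicographic comparison.
    induction j using (wellFounded_gt (α := Fin m)).induction with
    | _ j ih =>
    intro hkj
    have hnf : ∀ i, v i j ≠ 0 → ¬ InFlat v k i := fun i hi hf => hi (hf j hkj)
    -- Vectors with a nonzero higher coordinate are already settled. For the others `j` is the last
    -- nonzero coordinate, so `τ` maximizes each term separately. The terms sum to zero, hence all
    -- vanish.
    have hle : ∀ i ∈ (Finset.univ : Finset (Fin n)), (σ i - τ i) * v i j ≤ 0 := by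
      intro i _
      by_cases h0 : v i j = 0
      · simp [h0]
      by_cases h1 : ∃ j', j < j' ∧ v i j' ≠ 0
      · obtain ⟨j', hj', hv⟩ := h1
        rw [ih j' hj' (hkj.trans (Fin.le_def.1 hj'.le)) i hv]; simp
      push Not at h1
      have hp := lexPos_iff (fun l hl => h1 l hl) h0
      rw [← hJ i (hnf i h0)] at hp
      rw [hτ i (hnf i h0)]
      simp only [hp]
      split_ifs with hv
      · exact mul_nonpos_of_nonpos_of_nonneg (by linarith [(hσ i).2]) hv.le
      · exact mul_nonpos_of_nonneg_of_nonpos (by linarith [(hσ i).1]) (not_lt.1 hv)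
    have hsum : ∑ i, (σ i - τ i) * v i j = 0 := by
      have := h j hkj
      rw [comb_apply, comb_apply] at this
      simp [sub_mul, this]
    intro i hi
    have := (Finset.sum_eq_zero_iff_of_nonpos hle).1 hsum i (Finset.mem_univ i)
    rcases mul_eq_zero.1 this with h | h
    · linarith
    · contradiction
  unfold InFlat at hi
  push Not at hi
  obtain ⟨j, hj, hv⟩ := hi
  exact key j hj i hv

/-- The tiles of `P`, seen as faces of the cube `[0,1]^n`, form the image of a section of the
projection of the cube along `v`. -/
structure IsCubicalSection (v : Fin n → Fin m → ℝ) (P : Finset (Tile n)) : Prop where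
  disjoint : ∀ t ∈ P, Disjoint t.1 t.2
  inj : ∀ t ∈ P, ∀ t' ∈ P, ∀ σ σ', OnFace t.1 t.2 σ → OnFace t'.1 t'.2 σ' →
    comb v σ = comb v σ' → σ = σ'
  surj : ∀ σ : Fin n → ℝ, (∀ i, 0 ≤ σ i ∧ σ i ≤ 1) →
    ∃ t ∈ P, ∃ τ, OnFace t.1 t.2 τ ∧ comb v τ = comb v σ

/-- `(J, C)` is a face of a tile of `P`. -/
def IsCell (P : Finset (Tile n)) (J C : Finset (Fin n)) : Prop :=
  ∃ t ∈ P, IsFace J C t.1 t.2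

lemma IsCubicalSection.inj_cell {v : Fin n → Fin m → ℝ} {P : Finset (Tile n)}
    (hP : IsCubicalSection v P) {J C J' C' : Finset (Fin n)} (h : IsCell P J C)
    (h' : IsCell P J' C') {σ σ' : Fin n → ℝ} (hσ : OnFace J C σ) (hσ' : OnFace J' C' σ')
    (he : comb v σ = comb v σ') : σ = σ' := by
  obtain ⟨t, ht, hf⟩ := h
  obtain ⟨t', ht', hf'⟩ := h'
  exact hP.inj t ht t' ht' σ σ' (hσ.of_isFace hf) (hσ'.of_isFace hf') he

/-- The barycenter of the face of the cube labelled by `(J, C)`. -/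
noncomputable def faceCenter (J C : Finset (Fin n)) (i : Fin n) : ℝ :=
  if i ∈ J then 1 else if i ∈ C then 1 / 2 else 0

lemma onFace_faceCenter {J C : Finset (Fin n)} : OnFace J C (faceCenter J C) := by
  refine ⟨fun i => ?_, fun i hi => ?_, fun i hi hi' => ?_⟩ <;> unfold faceCenter
  · split_ifs <;> norm_num
  · simp [hi]
  · simp [hi, hi']

/-- The barycenter lies in the relative interior of its face: the coordinates in `C` equal `1/2`, so
any cube face containing it must leave them free. -/
lemma isFace_of_onFace_faceCenter {J C I B : Finset (Fin n)} (hJC : Disjoint J C)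
    (h : OnFace I B (faceCenter J C)) : IsFace J C I B := by
  obtain ⟨-, h1, h2⟩ := h
  have hI : I ⊆ J := fun i hi => by
    by_contra hiJ
    have := h1 i hi
    unfold faceCenter at this
    split_ifs at this <;> norm_num at this
  refine ⟨fun c hc => ?_, hI, fun i hi => ?_, hJC⟩
  · have hcJ : c ∉ J := Finset.disjoint_right.1 hJC hc
    by_contra hcB
    have := h2 c (fun h => hcJ (hI h)) hcB
    simp [faceCenter, hcJ, hc] at this
  · by_contra hiI
    simp only [Finset.mem_union, not_or] at hiI
    have := h2 i hiI.1 hiI.2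
    simp [faceCenter, hi] at this

/-- From the barycenter of a cell one can move a little in any direction permitted by the cube,
staying inside a single tile. -/
lemma IsCubicalSection.exists_step {v : Fin n → Fin m → ℝ} {P : Finset (Tile n)}
    (hP : IsCubicalSection v P) {J C : Finset (Fin n)} (hJ : IsCell P J C) {ρ : Fin n → ℝ}
    (hρ : ∀ δ : ℝ, 0 ≤ δ → δ ≤ 1 → ∀ i, 0 ≤ (faceCenter J C + δ • ρ) i ∧
      (faceCenter J C + δ • ρ) i ≤ 1) :
    ∃ t ∈ P, IsFace J C t.1 t.2 ∧ ∃ δ > (0 : ℝ), ∃ τ, OnFace t.1 t.2 τ ∧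
      comb v τ = comb v (faceCenter J C) + δ • comb v ρ := by
  set z : ℝ → Fin m → ℝ := fun δ => comb v (faceCenter J C) + δ • comb v ρ with hz
  have hzc : Continuous z := by fun_prop
  set K : Tile n → Set (Fin m → ℝ) := fun t => comb v '' {τ | OnFace t.1 t.2 τ} with hK
  have hKc : ∀ t, IsClosed (K t) := fun t =>
    ((isCompact_onFace t.1 t.2).image (continuous_comb v)).isClosed
  -- There are finitely many tiles, so one of them contains points of the segment arbitrarily close
  -- to its start. Being closed it contains the start too, whose only lift is the barycenter.
  have hfreq : ∃ t ∈ P, ∃ᶠ δ in 𝓝[>] (0 : ℝ), z δ ∈ K t := by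
    by_contra! hcon
    have h1 := (Filter.eventually_all_finset P).2 hcon
    have h2 : ∀ᶠ δ in 𝓝[>] (0 : ℝ), δ ∈ Set.Ioo (0 : ℝ) 1 := Ioo_mem_nhdsGT one_pos
    obtain ⟨δ, hδ1, hδ2⟩ := (h1.and h2).exists
    obtain ⟨t, ht, τ, hτ, he⟩ := hP.surj _ (hρ δ hδ2.1.le hδ2.2.le)
    refine hδ1 t ht ⟨τ, hτ, ?_⟩
    rw [he, comb_add, comb_smul]
  obtain ⟨t, ht, hfr⟩ := hfreq
  have hz0 : z 0 ∈ K t := by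
    refine (hKc t).mem_of_frequently_of_tendsto hfr ?_
    exact (hzc.tendsto 0).mono_left nhdsWithin_le_nhds
  obtain ⟨τ0, hτ0, he0⟩ := hz0
  obtain ⟨t1, ht1, hf1⟩ := hJ
  have : τ0 = faceCenter J C :=
    hP.inj t ht t1 ht1 _ _ hτ0 (onFace_faceCenter.of_isFace hf1) (by simpa [hz] using he0)
  subst this
  obtain ⟨δ, ⟨τ, hτ, he⟩, hδ⟩ := (hfr.and_eventually self_mem_nhdsWithin).exists
  exact ⟨t, ht, isFace_of_onFace_faceCenter hf1.2.2.2 hτ0, δ, hδ, τ, hτ, he⟩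

/-! ### Counting the cells parallel to an initial segment of a basis -/

/-- The first `k` elements of the family `b`. -/
def initial (b : Fin m → Fin n) (k : ℕ) : Finset (Fin n) :=
  (Finset.univ.filter fun j : Fin m => (j : ℕ) < k).image b

lemma mem_initial {b : Fin m → Fin n} {k : ℕ} {i : Fin n} :
    i ∈ initial b k ↔ ∃ j : Fin m, (j : ℕ) < k ∧ b j = i := by
  simp [initial]

lemma initial_succ (b : Fin m → Fin n) (j : Fin m) :
    initial b (j + 1) = insert (b j) (initial b j) := by
  ext i
  simp only [mem_initial, Finset.mem_insert]
  constructor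
  · rintro ⟨l, hl, rfl⟩
    rcases Nat.lt_succ_iff_lt_or_eq.1 hl with h | h
    · exact Or.inr ⟨l, h, rfl⟩
    · exact Or.inl (by rw [Fin.ext h])
  · rintro (rfl | ⟨l, hl, rfl⟩)
    · exact ⟨j, Nat.lt_succ_self _, rfl⟩
    · exact ⟨l, hl.trans (Nat.lt_succ_self _), rfl⟩

section Basis

variable {v : Fin n → Fin m → ℝ} {b : Fin m → Fin n} {P : Finset (Tile n)}

lemma notMem_initial (hb : ∀ j, v (b j) = Pi.single j 1) {j : Fin m} {i : Fin n}
    (hi : v i j ≠ 0) : i ∉ initial b j := by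
  rw [mem_initial]
  rintro ⟨l, hl, rfl⟩
  apply hi
  rw [hb, Pi.single_eq_of_ne]
  rintro rfl
  exact lt_irrefl _ hl

lemma inFlat_of_mem_initial (hb : ∀ j, v (b j) = Pi.single j 1) {k : ℕ} {i : Fin n}
    (hi : i ∈ initial b k) : InFlat v k i := by
  obtain ⟨l, hl, rfl⟩ := mem_initial.1 hi
  intro j hj
  rw [hb, Pi.single_eq_of_ne]
  rintro rfl
  omega

lemma inFlat_mono {k l : ℕ} (hkl : k ≤ l) {i : Fin n} (hi : InFlat v k i) : InFlat v l i :=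
  fun j hj => hi j (hkl.trans hj)

lemma lexTop_congr {k : ℕ} {J J' : Finset (Fin n)} (hJ : LexTop v k J)
    (h : ∀ i, ¬ InFlat v k i → (i ∈ J' ↔ i ∈ J)) : LexTop v k J' :=
  fun i hi => (h i hi).trans (hJ i hi)

open Classical in
/-- The cells parallel to the first `k` basis vectors in the lexicographically extreme face. -/
noncomputable def extremeCells (v : Fin n → Fin m → ℝ) (b : Fin m → Fin n)
    (P : Finset (Tile n)) (k l : ℕ) : Finset (Finset (Fin n)) :=
  Finset.univ.filter fun J => IsCell P J (initial b k) ∧ LexTop v l J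

open Classical in
/-- The cells spanned by the first `j` basis vectors and one more vector `v i`, with nonzero
coordinate `j`, in the face that is lexicographically extreme in the coordinates above `j`. -/
noncomputable def crossingCells (v : Fin n → Fin m → ℝ) (b : Fin m → Fin n)
    (P : Finset (Tile n)) (j : Fin m) : Finset (Finset (Fin n) × Fin n) :=
  Finset.univ.filter fun p => v p.2 j ≠ 0 ∧ InFlat v (j + 1) p.2 ∧
    IsCell P p.1 (insert p.2 (initial b j)) ∧ LexTop v (j + 1) p.1

open Classical in
/-- The facet of a crossing cell that is lower with respect to `ε` times coordinate `j`. -/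
noncomputable def lowerFacet (v : Fin n → Fin m → ℝ) (j : Fin m) (ε : ℝ)
    (p : Finset (Fin n) × Fin n) : Finset (Fin n) :=
  if 0 < ε * v p.2 j then p.1 else insert p.2 p.1

/-- There is room above `J` in the direction of `ε` times coordinate `j`. -/
def HasRoom (v : Fin n → Fin m → ℝ) (j : Fin m) (ε : ℝ) (J : Finset (Fin n)) : Prop :=
  ∃ i, InFlat v (j + 1) i ∧ ((i ∉ J ∧ 0 < ε * v i j) ∨ (i ∈ J ∧ ε * v i j < 0))

/-! ### Crossing cells and their facets -/

lemma mem_extremeCells {k l : ℕ} {J : Finset (Fin n)} :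
    J ∈ extremeCells v b P k l ↔ IsCell P J (initial b k) ∧ LexTop v l J := by
  simp [extremeCells]

lemma mem_crossingCells {j : Fin m} {p : Finset (Fin n) × Fin n} :
    p ∈ crossingCells v b P j ↔ v p.2 j ≠ 0 ∧ InFlat v (j + 1) p.2 ∧
      IsCell P p.1 (insert p.2 (initial b j)) ∧ LexTop v (j + 1) p.1 := by
  simp [crossingCells]

lemma notMem_of_mem_crossingCells {j : Fin m} {p : Finset (Fin n) × Fin n}
    (hp : p ∈ crossingCells v b P j) : p.2 ∉ p.1 := by
  obtain ⟨-, -, ⟨t, -, hf⟩, -⟩ := mem_crossingCells.1 hp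
  exact Finset.disjoint_right.1 hf.2.2.2 (Finset.mem_insert_self _ _)

lemma lowerFacet_mem (hb : ∀ j, v (b j) = Pi.single j 1) {j : Fin m} {ε : ℝ} (hε : ε ≠ 0)
    {p : Finset (Fin n) × Fin n} (hp : p ∈ crossingCells v b P j) :
    lowerFacet v j ε p ∈ extremeCells v b P j (j + 1) ∧ HasRoom v j ε (lowerFacet v j ε p) := by
  have hnm := notMem_of_mem_crossingCells hp
  obtain ⟨h0, hfl, ⟨t, ht, hC, hI, hJ, hd⟩, hlex⟩ := mem_crossingCells.1 hp
  have hlC := notMem_initial hb h0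
  rw [Finset.disjoint_insert_right] at hd
  rw [Finset.insert_subset_iff] at hC
  unfold lowerFacet
  split_ifs with hpos
  · exact ⟨mem_extremeCells.2 ⟨⟨t, ht, hC.2, hI, hJ, hd.2⟩, hlex⟩,
      p.2, hfl, Or.inl ⟨hnm, hpos⟩⟩
  · refine ⟨mem_extremeCells.2 ⟨⟨t, ht, hC.2, hI.trans (Finset.subset_insert _ _), ?_, ?_⟩, ?_⟩,
      p.2, hfl, Or.inr ⟨Finset.mem_insert_self _ _, ?_⟩⟩
    · exact Finset.insert_subset (Finset.mem_union_right _ hC.1) hJ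
    · exact Finset.disjoint_insert_left.2 ⟨hlC, hd.2⟩
    · refine lexTop_congr hlex fun i hi => ?_
      rw [Finset.mem_insert, or_iff_right]
      rintro rfl
      exact hi hfl
    · exact lt_of_le_of_ne (not_lt.1 hpos) (mul_ne_zero hε h0)

/-- Push the barycenter of the facet along a generator that leaves room. The tile entered must have
a generator with nonzero coordinate `j` transverse to the facet, and this generator spans the
crossing cell. -/
lemma exists_lowerFacet (hP : IsCubicalSection v P) (hb : ∀ j, v (b j) = Pi.single j 1)
    {j : Fin m} {ε : ℝ} {J : Finset (Fin n)}
    (hJ : J ∈ extremeCells v b P j (j + 1)) (hr : HasRoom v j ε J) :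
    ∃ p ∈ crossingCells v b P j, lowerFacet v j ε p = J := by
  obtain ⟨hcell, hlex⟩ := mem_extremeCells.1 hJ
  obtain ⟨i, hfl, hi⟩ := hr
  set C := initial b j with hC
  obtain ⟨s, hs, hsi⟩ : ∃ s : ℝ, 0 < ε * (s * v i j) ∧ ((s = 1 ∧ i ∉ J) ∨ (s = -1 ∧ i ∈ J)) := by
    rcases hi with ⟨h1, h2⟩ | ⟨h1, h2⟩
    · exact ⟨1, by simpa using h2, Or.inl ⟨rfl, h1⟩⟩
    · exact ⟨-1, by linarith, Or.inr ⟨rfl, h1⟩⟩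
  have hvi : v i j ≠ 0 := by rintro h; simp [h] at hs
  have hiC : i ∉ C := notMem_initial hb hvi
  obtain ⟨t, ht, hf, δ, hδ, τ, hτ, he⟩ := hP.exists_step hcell (ρ := Pi.single i s) (by
    intro δ h0 h1 l
    by_cases hl : l = i
    · subst hl
      rcases hsi with ⟨rfl, h⟩ | ⟨rfl, h⟩
      · simp [faceCenter, h, hiC, h0, h1]
      · simp [faceCenter, h, h0, h1]
    · simpa [hl] using (onFace_faceCenter (J := J) (C := C)).1 l)
  rw [comb_single] at he
  -- The displacement along `v i` does not change the coordinates above `j`, so extremality fixes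
  -- every coefficient outside the flat.
  have hext : ∀ l, ¬ InFlat v (j + 1) l → τ l = faceCenter J C l := by
    refine eq_of_lexTop hτ.1 hlex (fun l hl => ?_) fun j' hj' => ?_
    · have : l ∉ C := fun h => hl (inFlat_mono (Nat.le_succ _) (inFlat_of_mem_initial hb h))
      simp [faceCenter, this]
    · rw [he]; simp [hfl j' hj']
  -- Coordinate `j` of the projection moved strictly in direction `ε`, so some single coefficient
  -- `l` contributed positively. It changed within one tile, hence `l` is free there.
  have hsum : 0 < ∑ l, ε * ((τ l - faceCenter J C l) * v l j) := by
    have := congrFun he j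
    rw [Pi.add_apply, comb_apply, comb_apply] at this
    rw [← Finset.mul_sum]
    simp only [sub_mul, Finset.sum_sub_distrib, this]
    have h2 := mul_pos hδ hs
    simp only [Pi.smul_apply, smul_eq_mul]
    linarith
  obtain ⟨l, -, hl⟩ : ∃ l ∈ (Finset.univ : Finset (Fin n)),
      0 < ε * ((τ l - faceCenter J C l) * v l j) := by
    by_contra! hcon
    exact absurd hsum (not_lt.2 (Finset.sum_nonpos hcon))
  have hne : τ l ≠ faceCenter J C l := by intro h; simp [h] at hl
  have hvl : v l j ≠ 0 := by intro h; simp [h] at hl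
  have hlfl : InFlat v (j + 1) l := by by_contra h; exact hne (hext l h)
  have hlC : l ∉ C := notMem_initial hb hvl
  have hσ0 := (onFace_faceCenter (J := J) (C := C)).of_isFace hf
  have hlI : l ∉ t.1 := fun h => hne ((hτ.2.1 l h).trans (hσ0.2.1 l h).symm)
  have hlB : l ∈ t.2 := by
    by_contra h
    exact hne ((hτ.2.2 l hlI h).trans (hσ0.2.2 l hlI h).symm)
  obtain ⟨hCB, hIJ, hJ', hd⟩ := hf
  by_cases hpos : 0 < ε * v l j
  · have hlJ : l ∉ J := by
      intro h
      have h1 : faceCenter J C l = 1 := by simp [faceCenter, h]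
      have h2 := (hτ.1 l).2
      nlinarith
    refine ⟨(J, l), mem_crossingCells.2 ⟨hvl, hlfl, ⟨t, ht, ?_, hIJ, hJ', ?_⟩, hlex⟩, ?_⟩
    · exact Finset.insert_subset hlB hCB
    · exact Finset.disjoint_insert_right.2 ⟨hlJ, hd⟩
    · simp [lowerFacet, hpos]
  · have hlJ : l ∈ J := by
      by_contra h
      have h1 : faceCenter J C l = 0 := by simp [faceCenter, h, hlC]
      have h2 := (hτ.1 l).1
      nlinarith
    refine ⟨(J.erase l, l), mem_crossingCells.2 ⟨hvl, hlfl, ⟨t, ht, ?_, ?_, ?_, ?_⟩, ?_⟩, ?_⟩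
    · exact Finset.insert_subset hlB hCB
    · exact fun x hx => Finset.mem_erase.2 ⟨fun h => hlI (h ▸ hx), hIJ hx⟩
    · exact (Finset.erase_subset _ _).trans hJ'
    · exact Finset.disjoint_insert_right.2
        ⟨Finset.notMem_erase _ _, hd.mono_left (Finset.erase_subset _ _)⟩
    · refine lexTop_congr hlex fun x hx => ?_
      rw [Finset.mem_erase, and_iff_right]
      rintro rfl
      exact hx hlfl
    · simp [lowerFacet, hpos, Finset.insert_erase hlJ]

/-- Points near the barycenter of the lower facet of a crossing cell, on its upper side, lie in that
cell. -/
lemma onFace_of_lowerFacet (hb : ∀ j, v (b j) = Pi.single j 1) {j : Fin m} {ε : ℝ}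
    {p : Finset (Fin n) × Fin n} (hp : p ∈ crossingCells v b P j) {s γ : ℝ}
    (hs : s = if 0 < ε * v p.2 j then 1 else -1) (hγ : 0 ≤ γ) (hγ' : γ ≤ 1) {ρ : Fin n → ℝ}
    (hρ : ∀ i, |ρ i| ≤ 1 / 2) (hρ' : ∀ i, i ∉ initial b j → ρ i = 0) :
    OnFace p.1 (insert p.2 (initial b j))
      (faceCenter (lowerFacet v j ε p) (initial b j) + Pi.single p.2 (γ * s) + ρ) := by
  have hnm := notMem_of_mem_crossingCells hp
  obtain ⟨h0, hfl, ⟨t, ht, hC, hI, hJ, hd⟩, hlex⟩ := mem_crossingCells.1 hp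
  have hlC := notMem_initial hb h0
  rw [Finset.disjoint_insert_right] at hd
  have hmem : ∀ i, i ≠ p.2 → (i ∈ lowerFacet v j ε p ↔ i ∈ p.1) := by
    intro i hi
    unfold lowerFacet
    split_ifs <;> simp [hi]
  have hval : ∀ i, i ≠ p.2 → (faceCenter (lowerFacet v j ε p) (initial b j) +
      Pi.single p.2 (γ * s) + ρ : Fin n → ℝ) i = faceCenter p.1 (initial b j) i + ρ i := by
    intro i hi
    simp [hi, faceCenter, hmem i hi]
  refine ⟨fun i => ?_, fun i hi => ?_, fun i hi hi' => ?_⟩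
  · by_cases hi : i = p.2
    · subst hi
      simp only [Pi.add_apply, Pi.single_eq_same, hρ' _ hlC, hs, faceCenter, hlC, lowerFacet]
      split_ifs <;> simp_all
    · rw [hval i hi]
      by_cases hiC : i ∈ initial b j
      · have := Finset.disjoint_right.1 hd.2 hiC
        have h2 := abs_le.1 (hρ i)
        simp only [faceCenter, this, hiC, if_true, if_false]
        constructor <;> linarith
      · rw [hρ' i hiC, add_zero]
        exact onFace_faceCenter.1 i
  · have hne : i ≠ p.2 := fun h => hnm (h ▸ hi)
    have : i ∉ initial b j := Finset.disjoint_left.1 hd.2 hi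
    rw [hval i hne, hρ' i this, add_zero]
    exact onFace_faceCenter.2.1 i hi
  · rw [Finset.mem_insert, not_or] at hi'
    rw [hval i hi'.1, hρ' i hi'.2, add_zero]
    exact onFace_faceCenter.2.2 i hi hi'.2

/-- Two crossing cells on the same side of a common facet would overlap near its barycenter, giving
one projected point two lifts. -/
lemma lowerFacet_injOn (hP : IsCubicalSection v P) (hb : ∀ j, v (b j) = Pi.single j 1)
    {j : Fin m} {ε : ℝ} (hε : ε ≠ 0) :
    Set.InjOn (lowerFacet v j ε) (crossingCells v b P j) := by
  intro p hp q hq hpq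
  rw [Finset.mem_coe] at hp hq
  have hnp := notMem_of_mem_crossingCells hp
  have hnq := notMem_of_mem_crossingCells hq
  obtain ⟨hp0, hpfl, hpc, -⟩ := mem_crossingCells.1 hp
  obtain ⟨hq0, hqfl, hqc, -⟩ := mem_crossingCells.1 hq
  by_cases hl : p.2 = q.2
  · refine Prod.ext ?_ hl
    unfold lowerFacet at hpq
    rw [← hl] at hpq hnq
    split_ifs at hpq with h
    · exact hpq
    · rw [← Finset.erase_insert hnp, hpq, Finset.erase_insert hnq]
  exfalso
  have hbinj : Function.Injective b := by
    intro x y hxy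
    by_contra hne
    have h1 := congrFun (hb x) x
    rw [hxy, hb y, Pi.single_eq_same, Pi.single_eq_of_ne hne] at h1
    exact zero_ne_one h1
  have sign : ∀ x : ℝ, x ≠ 0 → ∃ s : ℝ, (s = if 0 < ε * x then 1 else -1) ∧ 0 < ε * (s * x) := by
    intro x hx
    refine ⟨_, rfl, ?_⟩
    split_ifs with h
    · simpa using h
    · have : ε * x < 0 := lt_of_le_of_ne (not_lt.1 h) (mul_ne_zero hε hx)
      linarith
  obtain ⟨s, hs, hsp⟩ := sign _ hp0
  obtain ⟨s', hs', hsq⟩ := sign _ hq0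
  have hs0 : s * v p.2 j ≠ 0 := right_ne_zero_of_mul hsp.ne'
  have hs'0 : s' ≠ 0 := left_ne_zero_of_mul (right_ne_zero_of_mul hsq.ne')
  -- Scaling by `c` equalizes the rise in coordinate `j`. The remaining difference `r` lies in the
  -- span of the first `j` basis vectors, and `ρ` realizes it by moving inside the facet.
  set c := (s' * v q.2 j) / (s * v p.2 j) with hc
  have hcpos : 0 < c := by
    rw [hc, ← mul_div_mul_left _ _ hε]
    exact div_pos hsq hsp
  set r : Fin m → ℝ := s' • v q.2 - (c * s) • v p.2 with hr
  have hr0 : ∀ l : Fin m, (j : ℕ) ≤ l → r l = 0 := by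
    intro l hl
    rcases hl.lt_or_eq with h | h
    · simp [hr, hqfl l h, hpfl l h]
    · rw [← Fin.ext h]
      simp only [hr, Pi.sub_apply, Pi.smul_apply, smul_eq_mul, mul_assoc]
      rw [hc, div_mul_cancel₀ _ hs0, sub_self]
  set ρ : Fin n → ℝ := fun i => ∑ l, if b l = i then r l else 0 with hρdef
  have hρb : ∀ l, ρ (b l) = r l := by
    intro l
    rw [hρdef]
    simp only [hbinj.eq_iff]
    simp
  have hρ0 : ∀ i, i ∉ initial b j → ρ i = 0 := by
    intro i hi
    refine Finset.sum_eq_zero fun l _ => ?_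
    split_ifs with h
    · refine hr0 l ?_
      by_contra hlt
      exact hi (mem_initial.2 ⟨l, not_le.1 hlt, h⟩)
    · rfl
  have hcomb : comb v ρ = r := by
    ext l
    rw [comb_apply]
    simp only [hρdef, Finset.sum_mul]
    rw [Finset.sum_comm]
    simp [ite_mul, hb, Pi.single_apply]
  -- A common bound for `1`, `c` and all `|ρ i|`; with `δ * M = 1 / 2` both displaced points stay in
  -- their cells.
  set M := 1 + c + ∑ l, |r l| with hM
  have hsumnn : 0 ≤ ∑ l, |r l| := Finset.sum_nonneg fun l _ => abs_nonneg _
  have hM1 : 1 ≤ M := by linarith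
  have hMc : c ≤ M := by linarith
  have hMr : ∀ i, |ρ i| ≤ M := by
    intro i
    by_cases hi : i ∈ initial b j
    · obtain ⟨l, -, rfl⟩ := mem_initial.1 hi
      rw [hρb]
      have := Finset.single_le_sum (f := fun l => |r l|) (fun l _ => abs_nonneg _)
        (Finset.mem_univ l)
      linarith
    · rw [hρ0 i hi, abs_zero]; linarith
  obtain ⟨δ, hδ, hδM⟩ : ∃ δ : ℝ, 0 < δ ∧ δ * M = 1 / 2 :=
    ⟨1 / 2 / M, by positivity, by field_simp⟩
  have hbd : ∀ x, x ≤ M → δ * x ≤ 1 / 2 := fun x hx =>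
    (mul_le_mul_of_nonneg_left hx hδ.le).trans hδM.le
  have h1 := onFace_of_lowerFacet hb hp hs (γ := δ * c) (ρ := δ • ρ) (by positivity)
    (by linarith [hbd c hMc])
    (fun i => by simpa [abs_mul, abs_of_pos hδ] using hbd _ (hMr i))
    (fun i hi => by simp [hρ0 i hi])
  have h2 := onFace_of_lowerFacet hb hq hs' (γ := δ) (ρ := 0) hδ.le
    (by linarith [hbd 1 hM1]) (fun i => by simp) (fun i _ => rfl)
  have heq := hP.inj_cell hpc hqc h1 h2 (by
    simp only [comb_add, comb_smul, comb_single, hcomb, hpq, add_zero, hr]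
    module)
  -- Only the lift in the cell of `q` is displaced in coordinate `q.2`, by `δ * s' ≠ 0`.
  have := congrFun heq q.2
  rw [hpq] at this
  simp [Ne.symm hl, hρ0 _ (notMem_initial hb hq0), hδ.ne', hs'0] at this

open Classical in
lemma card_lowerFacet_mem (hP : IsCubicalSection v P) (hb : ∀ j, v (b j) = Pi.single j 1)
    (j : Fin m) {ε : ℝ} (hε : ε ≠ 0) :
    ((crossingCells v b P j).filter fun p => b j ∈ lowerFacet v j ε p).card =
      ((extremeCells v b P j (j + 1)).filter fun J => HasRoom v j ε J ∧ b j ∈ J).card := by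
  refine Finset.card_bij (fun p _ => lowerFacet v j ε p) (fun p hp => ?_) (fun p hp q hq h => ?_)
    fun J hJ => ?_
  · rw [Finset.mem_filter] at hp ⊢
    have := lowerFacet_mem hb hε hp.1
    exact ⟨this.1, this.2, hp.2⟩
  · exact lowerFacet_injOn hP hb hε (Finset.mem_filter.1 hp).1 (Finset.mem_filter.1 hq).1 h
  · obtain ⟨h1, h2, h3⟩ := Finset.mem_filter.1 hJ
    obtain ⟨p, hp, rfl⟩ := exists_lowerFacet hP hb h1 h2
    exact ⟨p, Finset.mem_filter.2 ⟨hp, h3⟩, rfl⟩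

/-! ### The inductive count -/

lemma inFlat_basis (hb : ∀ j, v (b j) = Pi.single j 1) (j : Fin m) :
    InFlat v (j + 1) (b j) :=
  inFlat_of_mem_initial hb (mem_initial.2 ⟨j, Nat.lt_succ_self _, rfl⟩)

/-- Once the higher coordinates are extreme, the only further condition concerns vectors whose last
nonzero coordinate is `j`; it fails exactly when switching one of them raises coordinate `j`. -/
lemma lexTop_iff_not_hasRoom {j : Fin m} {J : Finset (Fin n)} (hJ : LexTop v (j + 1) J) :
    LexTop v j J ↔ ¬ HasRoom v j 1 J := by
  constructor
  · rintro h ⟨i, hfl, hi⟩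
    have hv : v i j ≠ 0 := by
      rintro h0
      simp [h0] at hi
    have h1 := (h i fun hf => hv (hf j le_rfl)).trans (lexPos_iff hfl hv)
    rw [one_mul] at hi
    rcases hi with ⟨h2, h3⟩ | ⟨h2, h3⟩
    · exact h2 (h1.2 h3)
    · exact h3.not_gt (h1.1 h2)
  · intro h i hi
    by_cases hfl : InFlat v (j + 1) i
    · have hv : v i j ≠ 0 := by
        intro h0
        refine hi fun l hl => ?_
        rcases hl.lt_or_eq with h | h
        · exact hfl l h
        · rw [← Fin.ext h, h0]
      rw [lexPos_iff hfl hv]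
      constructor
      · intro hiJ
        by_contra hneg
        exact h ⟨i, hfl, Or.inr ⟨hiJ, by rw [one_mul]; exact lt_of_le_of_ne (not_lt.1 hneg) hv⟩⟩
      · intro hpos
        by_contra hiJ
        exact h ⟨i, hfl, Or.inl ⟨hiJ, by rwa [one_mul]⟩⟩
    · exact hJ i hfl

lemma lexTop_succ {k : ℕ} {J : Finset (Fin n)} (hJ : LexTop v k J) : LexTop v (k + 1) J :=
  fun i hi => hJ i fun h => hi (inFlat_mono (Nat.le_succ k) h)

/-- Since `b j` has positive coordinate `j`, a crossing cell generated by `b j` gains it from lower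
to upper facet, while any other crossing cell has it in both facets or in neither. Comparing the
counts for `ε = 1` and `ε = -1` isolates the cells generated by `b j`. -/
lemma card_extremeCells_succ (hP : IsCubicalSection v P) (hb : ∀ j, v (b j) = Pi.single j 1)
    (j : Fin m) :
    (extremeCells v b P (j + 1) (j + 1)).card = (extremeCells v b P j j).card := by
  classical
  have hbj : v (b j) j = 1 := by simp [hb]
  set Y := extremeCells v b P j (j + 1) with hY
  set T := crossingCells v b P j with hT
  have h1 : (T.filter fun p => b j ∈ lowerFacet v j 1 p) = T.filter fun p => b j ∈ p.1 := by
    refine Finset.filter_congr fun p hp => ?_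
    unfold lowerFacet
    split_ifs with h
    · rfl
    · rw [Finset.mem_insert, or_iff_right]
      intro he
      rw [← he, hbj] at h
      norm_num at h
  have h2 : (T.filter fun p => b j ∈ lowerFacet v j (-1) p) =
      (T.filter fun p => b j ∈ p.1) ∪ T.filter fun p => p.2 = b j := by
    rw [← Finset.filter_or]
    refine Finset.filter_congr fun p hp => ?_
    unfold lowerFacet
    split_ifs with h
    · rw [or_iff_left]
      intro he
      rw [he, hbj] at h
      norm_num at h
    · rw [Finset.mem_insert, or_comm, eq_comm]
  have h2d : Disjoint (T.filter fun p => b j ∈ p.1) (T.filter fun p => p.2 = b j) := by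
    rw [Finset.disjoint_filter]
    intro p hp h he
    exact notMem_of_mem_crossingCells hp (he ▸ h)
  -- Room downwards is automatic: `b j` itself can be switched off.
  have h3 : (Y.filter fun J => HasRoom v j (-1) J ∧ b j ∈ J) = Y.filter fun J => b j ∈ J := by
    refine Finset.filter_congr fun J _ => and_iff_right_of_imp fun h => ?_
    exact ⟨b j, inFlat_basis hb j, Or.inr ⟨h, by rw [hbj]; norm_num⟩⟩
  -- Facets without room upwards are the topmost ones, and these contain `b j` because it is
  -- lexicographically positive.
  have h4 : (Y.filter fun J => b j ∈ J) =
      (Y.filter fun J => HasRoom v j 1 J ∧ b j ∈ J) ∪ extremeCells v b P j j := by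
    ext J
    simp only [Finset.mem_union, Finset.mem_filter, hY, mem_extremeCells]
    constructor
    · rintro ⟨⟨hc, hl⟩, hJ⟩
      by_cases hr : HasRoom v j 1 J
      · exact Or.inl ⟨⟨hc, hl⟩, hr, hJ⟩
      · exact Or.inr ⟨hc, (lexTop_iff_not_hasRoom hl).2 hr⟩
    · rintro (⟨h, -, hJ⟩ | ⟨hc, hl⟩)
      · exact ⟨h, hJ⟩
      · refine ⟨⟨hc, lexTop_succ hl⟩, (hl _ ?_).2 ?_⟩
        · intro hf
          exact one_ne_zero (hbj.symm.trans (hf j le_rfl))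
        · rw [lexPos_iff (inFlat_basis hb j) (by rw [hbj]; exact one_ne_zero), hbj]
          exact one_pos
  have h4d : Disjoint (Y.filter fun J => HasRoom v j 1 J ∧ b j ∈ J)
      (extremeCells v b P j j) := by
    rw [Finset.disjoint_left]
    intro J hJ hJ'
    have hl := (mem_extremeCells.1 hJ').2
    exact (lexTop_iff_not_hasRoom (lexTop_succ hl)).1 hl (Finset.mem_filter.1 hJ).2.1
  have h5 : (T.filter fun p => p.2 = b j).card =
      (extremeCells v b P (j + 1) (j + 1)).card := by
    refine Finset.card_bij (fun p _ => p.1) (fun p hp => ?_) (fun p hp q hq h => ?_)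
      fun J hJ => ?_
    · obtain ⟨hp, he⟩ := Finset.mem_filter.1 hp
      obtain ⟨-, -, hc, hl⟩ := mem_crossingCells.1 hp
      rw [he, ← initial_succ] at hc
      exact mem_extremeCells.2 ⟨hc, hl⟩
    · exact Prod.ext h
        ((Finset.mem_filter.1 hp).2.trans (Finset.mem_filter.1 hq).2.symm)
    · obtain ⟨hc, hl⟩ := mem_extremeCells.1 hJ
      rw [initial_succ] at hc
      exact ⟨(J, b j), Finset.mem_filter.2 ⟨mem_crossingCells.2
        ⟨by rw [hbj]; exact one_ne_zero, inFlat_basis hb j, hc, hl⟩, rfl⟩, rfl⟩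
  have e1 := card_lowerFacet_mem hP hb j (one_ne_zero (α := ℝ))
  have e2 := card_lowerFacet_mem hP hb j (neg_ne_zero.2 (one_ne_zero (α := ℝ)))
  rw [h1] at e1
  rw [h2, Finset.card_union_of_disjoint h2d, h3, h4, Finset.card_union_of_disjoint h4d, ← e1,
    h5] at e2
  omega

/-- As no vector is zero, extremality determines every coefficient. The extreme vertex has only
itself as preimage in the cube, so some tile must contain it. -/
lemma card_extremeCells_zero (hP : IsCubicalSection v P) (hv : ∀ i, v i ≠ 0) :
    (extremeCells v b P 0 0).card = 1 := by
  classical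
  have hnf : ∀ i, ¬ InFlat v 0 i := fun i hi => hv i (funext fun j => hi j (Nat.zero_le _))
  have hinit : initial b 0 = ∅ := by simp [initial]
  set J : Finset (Fin n) := Finset.univ.filter fun i => LexPos v i with hJ
  have hlex : LexTop v 0 J := fun i _ => by simp [hJ]
  rw [Finset.card_eq_one]
  refine ⟨J, Finset.ext fun J' => ?_⟩
  rw [mem_extremeCells, Finset.mem_singleton, hinit]
  constructor
  · rintro ⟨-, h⟩
    ext i
    rw [h i (hnf i), hlex i (hnf i)]
  · rintro rfl
    refine ⟨?_, hlex⟩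
    obtain ⟨t, ht, τ, hτ, he⟩ := hP.surj (faceCenter J ∅) onFace_faceCenter.1
    have : τ = faceCenter J ∅ := funext fun i =>
      eq_of_lexTop hτ.1 hlex (fun i _ => by simp [faceCenter]) (fun j _ => by rw [he]) i (hnf i)
    exact ⟨t, ht, isFace_of_onFace_faceCenter (Finset.disjoint_empty_right _) (this ▸ hτ)⟩

/-- Every basis is the label of exactly one tile of a cubical section. -/
theorem IsCubicalSection.existsUnique_tile (hP : IsCubicalSection v P)
    (hb : ∀ j, v (b j) = Pi.single j 1) (hv : ∀ i, v i ≠ 0)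
    (hcard : ∀ t ∈ P, t.2.card = m) : ∃! t, t ∈ P ∧ t.2 = Finset.univ.image b := by
  have key : ∀ k ≤ m, (extremeCells v b P k k).card = 1 := by
    intro k
    induction k with
    | zero => exact fun _ => card_extremeCells_zero hP hv
    | succ k ih =>
      intro hk
      exact (card_extremeCells_succ hP hb ⟨k, hk⟩).trans (ih (Nat.le_of_succ_le hk))
  have hinit : initial b m = Finset.univ.image b := by simp [initial]
  have hbinj : Function.Injective b := by
    intro x y hxy
    by_contra hne
    have h1 := congrFun (hb x) x
    rw [hxy, hb y, Pi.single_eq_same, Pi.single_eq_of_ne hne] at h1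
    exact zero_ne_one h1
  obtain ⟨J, hJ⟩ := Finset.card_eq_one.1 (key m le_rfl)
  -- For `k = m` every vector lies in the flat, so the extremality condition is void.
  have hmem : ∀ J', J' ∈ extremeCells v b P m m ↔ IsCell P J' (Finset.univ.image b) := by
    intro J'
    rw [mem_extremeCells, hinit, and_iff_left]
    exact fun i hi => absurd (fun j hj => absurd j.2 (not_lt.2 hj)) hi
  obtain ⟨t, ht, hC, hI, hJ', hd⟩ := (hmem J).1 (hJ ▸ Finset.mem_singleton_self J)
  have hB : t.2 = Finset.univ.image b := by
    refine (Finset.eq_of_subset_of_card_le hC ?_).symm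
    rw [hcard t ht, Finset.card_image_of_injective _ hbinj, Finset.card_fin]
  refine ⟨t, ⟨ht, hB⟩, ?_⟩
  have hcell : ∀ t' ∈ P, t'.2 = Finset.univ.image b → t'.1 = J := by
    intro t' ht' hB'
    rw [← Finset.mem_singleton, ← hJ, hmem]
    exact ⟨t', ht', hB' ▸ subset_rfl, subset_rfl, Finset.subset_union_left,
      hB' ▸ hP.disjoint t' ht'⟩
  rintro t' ⟨ht', hB'⟩
  exact Prod.ext ((hcell t' ht' hB').trans (hcell t ht hB).symm) (hB'.trans hB.symm)

end Basis

end Core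

end ZonotopalSplines

namespace ZonotopalSplines

/-! ### Fine zonotopal tilings as cubical sections -/

section Tilings

variable {n d : ℕ}

lemma OnFace.sum_smul {E : Type*} [AddCommGroup E] [Module ℝ E] {I B : Finset (Fin n)}
    {σ : Fin n → ℝ} (hd : Disjoint I B) (h : OnFace I B σ) (w : Fin n → E) :
    ∑ i, σ i • w i = ∑ i ∈ I, w i + ∑ b ∈ B, σ b • w b := by
  rw [← Finset.sum_subset (Finset.subset_univ (I ∪ B)), Finset.sum_union hd]
  · congr 1
    exact Finset.sum_congr rfl fun i hi => by rw [h.2.1 i hi, one_smul]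
  · intro i _ hi
    rw [Finset.mem_union, not_or] at hi
    rw [h.2.2 i hi.1 hi.2, zero_smul]

lemma mem_parallelepiped_iff {a : Fin n → Fin d → ℝ} {I B : Finset (Fin n)} (hd : Disjoint I B)
    {z : Fin (d + 1) → ℝ} :
    z ∈ parallelepiped a I B ↔ ∃ σ, OnFace I B σ ∧ ∑ i, σ i • lift (a i) = z := by
  constructor
  · rintro ⟨α, hα, rfl⟩
    have hB : ∀ i ∈ B, i ∉ I := fun i hi => Finset.disjoint_right.1 hd hi
    have hσ : OnFace I B fun i => if i ∈ I then 1 else if i ∈ B then α i else 0 := by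
      refine ⟨fun i => ?_, fun i hi => by simp [hi], fun i hi hi' => by simp [hi, hi']⟩
      dsimp only
      split_ifs with h1 h2
      · norm_num
      · exact hα i h2
      · norm_num
    refine ⟨_, hσ, ?_⟩
    rw [hσ.sum_smul hd]
    congr 1
    exact Finset.sum_congr rfl fun i hi => by simp [hi, hB i hi]
  · rintro ⟨σ, hσ, rfl⟩
    exact ⟨σ, fun b _ => hσ.1 b, hσ.sum_smul hd _⟩

lemma OnFace.eq_of_sum_eq {E : Type*} [AddCommGroup E] [Module ℝ E] {I B : Finset (Fin n)}
    {σ τ : Fin n → ℝ} {w : Fin n → E} (hd : Disjoint I B)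
    (hw : LinearIndependent ℝ fun b : B => w b)
    (hσ : OnFace I B σ) (hτ : OnFace I B τ) (h : ∑ i, σ i • w i = ∑ i, τ i • w i) : σ = τ := by
  rw [hσ.sum_smul hd, hτ.sum_smul hd, add_right_inj, ← sub_eq_zero,
    ← Finset.sum_sub_distrib, ← Finset.sum_coe_sort B] at h
  simp only [← sub_smul] at h
  have h0 := Fintype.linearIndependent_iff.1 hw _ h
  ext i
  by_cases hI : i ∈ I
  · rw [hσ.2.1 i hI, hτ.2.1 i hI]
  by_cases hB : i ∈ B
  · exact sub_eq_zero.1 (h0 ⟨i, hB⟩)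
  · rw [hσ.2.2 i hI hB, hτ.2.2 i hI hB]

lemma linearIndependent_lift_iff {ι : Type*} (p : ι → Fin d → ℝ) :
    LinearIndependent ℝ (fun i => lift (p i)) ↔ AffineIndependent ℝ p := by
  rw [affineIndependent_iff, linearIndependent_iff']
  refine forall₂_congr fun s w => ?_
  rw [← and_imp]
  refine imp_congr_left ⟨fun h => ⟨?_, ?_⟩, fun ⟨h1, h2⟩ => ?_⟩
  · simpa [lift, Finset.sum_apply] using congrFun h (Fin.last d)
  · ext j
    simpa [lift, Finset.sum_apply] using congrFun h j.castSucc
  · ext j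
    refine Fin.lastCases ?_ (fun j => ?_) j
    · simpa [lift, Finset.sum_apply] using h1
    · simpa [lift, Finset.sum_apply] using congrFun h2 j

lemma linearIndependent_orderEmbOfFin_iff {E : Type*} [AddCommGroup E] [Module ℝ E]
    {B : Finset (Fin n)} (h : B.card = d + 1) (w : Fin n → E) :
    LinearIndependent ℝ (fun r => w (B.orderEmbOfFin h r)) ↔
      LinearIndependent ℝ fun b : B => w b :=
  linearIndependent_equiv (B.orderIsoOfFin h).toEquiv (f := fun b : B => w b)

lemma det_pos_iff (a : Fin n → Fin d → ℝ) {B : Finset (Fin n)} (h : B.card = d + 1) :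
    0 < det a B ↔ AffineIndependent ℝ fun b : B => a b := by
  rw [det, dif_pos h, abs_pos, ← linearIndependent_lift_iff,
    ← linearIndependent_orderEmbOfFin_iff h (fun i => lift (a i)), ← isUnit_iff_ne_zero,
    ← Matrix.isUnit_iff_isUnit_det, ← Matrix.linearIndependent_rows_iff_isUnit]
  rfl

lemma lift_ne_zero (x : Fin d → ℝ) : lift x ≠ 0 := fun h => by
  simpa [lift] using congrFun h (Fin.last d)

/-- A fine zonotopal tiling is a cubical section in every linear coordinate system. -/
lemma IsFineZonotopalTiling.isCubicalSection {a : Fin n → Fin d → ℝ} {P : Finset (Tile n)}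
    (hP : IsFineZonotopalTiling a P) {m : ℕ} (φ : (Fin (d + 1) → ℝ) ≃ₗ[ℝ] (Fin m → ℝ)) :
    IsCubicalSection (fun i => φ (lift (a i))) P := by
  have hcomb : ∀ σ, comb (fun i => φ (lift (a i))) σ = φ (∑ i, σ i • lift (a i)) := by
    intro σ
    simp [comb]
  have hli : ∀ t ∈ P, LinearIndependent ℝ fun b : t.2 => lift (a b) := fun t ht =>
    (linearIndependent_lift_iff _).2 ((det_pos_iff a (hP.card_eq t ht)).1 (hP.det_pos t ht))
  refine ⟨hP.disjoint, fun t ht t' ht' σ σ' hσ hσ' h => ?_, fun σ hσ => ?_⟩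
  · rw [hcomb, hcomb, φ.injective.eq_iff] at h
    have hz : ∑ i, σ i • lift (a i) ∈ parallelepiped a t.1 t.2 ∩ parallelepiped a t'.1 t'.2 :=
      ⟨(mem_parallelepiped_iff (hP.disjoint t ht)).2 ⟨σ, hσ, rfl⟩,
        (mem_parallelepiped_iff (hP.disjoint t' ht')).2 ⟨σ', hσ', h.symm⟩⟩
    obtain ⟨J, C, hf, hf', he⟩ := hP.inter t ht t' ht' ⟨_, hz⟩
    rw [he, mem_parallelepiped_iff hf.2.2.2] at hz
    obtain ⟨ρ, hρ, hρe⟩ := hz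
    -- The common face carries the same label in both tiles, so its single lift `ρ` must agree with
    -- both `σ` and `σ'`.
    have h1 : ρ = σ := OnFace.eq_of_sum_eq (w := fun i => lift (a i)) (hP.disjoint t ht)
      (hli t ht) (hρ.of_isFace hf) hσ hρe
    have h2 : ρ = σ' := OnFace.eq_of_sum_eq (w := fun i => lift (a i)) (hP.disjoint t' ht')
      (hli t' ht') (hρ.of_isFace hf') hσ' (hρe.trans h)
    exact h1.symm.trans h2
  · have hz : ∑ i, σ i • lift (a i) ∈ zonotope a := ⟨σ, hσ, rfl⟩
    rw [← hP.cover] at hz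
    simp only [Set.mem_iUnion] at hz
    obtain ⟨t, ht, hz⟩ := hz
    obtain ⟨τ, hτ, he⟩ := (mem_parallelepiped_iff (hP.disjoint t ht)).1 hz
    exact ⟨t, ht, τ, hτ, by rw [hcomb, hcomb, he]⟩

/-- In a fine zonotopal tiling every affinely independent set of `d + 1` indices is the label of
exactly one tile. -/
theorem IsFineZonotopalTiling.existsUnique_tile {a : Fin n → Fin d → ℝ} {P : Finset (Tile n)}
    (hP : IsFineZonotopalTiling a P) {B : Finset (Fin n)} (hB : B.card = d + 1)
    (hB' : AffineIndependent ℝ fun b : B => a b) : ∃! t, t ∈ P ∧ t.2 = B := by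
  have hli := (linearIndependent_orderEmbOfFin_iff hB fun i => lift (a i)).2
    ((linearIndependent_lift_iff _).2 hB')
  let bas := basisOfLinearIndependentOfCardEqFinrank hli (by simp)
  have hbas : ∀ j, bas j = lift (a (B.orderEmbOfFin hB j)) := fun j => by simp [bas]
  -- Coordinates with respect to the lifted points of `B` turn them into the standard basis.
  have h := (hP.isCubicalSection bas.equivFun).existsUnique_tile
    (b := B.orderEmbOfFin hB)
    (fun j => by
      rw [← hbas]
      ext l
      simp [Pi.single_apply, eq_comm])
    (fun i => by simpa using lift_ne_zero (a i)) hP.card_eq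
  have himage : Finset.univ.image (B.orderEmbOfFin hB) = B := by simp
  rwa [himage] at h

theorem IsFineZonotopalTiling.card_eq_ncard {a : Fin n → Fin d → ℝ} {P : Finset (Tile n)}
    (hP : IsFineZonotopalTiling a P) :
    P.card = {B : Finset (Fin n) |
      B.card = d + 1 ∧ AffineIndependent ℝ (fun b : B => a b)}.ncard := by
  have hset : {B : Finset (Fin n) | B.card = d + 1 ∧ AffineIndependent ℝ (fun b : B => a b)} =
      (P.image Prod.snd : Finset (Finset (Fin n))) := by
    ext B
    simp only [Set.mem_ofPred_eq, Finset.coe_image, Set.mem_image, Finset.mem_coe]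
    constructor
    · rintro ⟨h1, h2⟩
      exact (hP.existsUnique_tile h1 h2).exists
    · rintro ⟨t, ht, rfl⟩
      exact ⟨hP.card_eq t ht, (det_pos_iff a (hP.card_eq t ht)).1 (hP.det_pos t ht)⟩
  rw [hset, Set.ncard_coe_finset, Finset.card_image_of_injOn]
  intro t ht t' ht' h
  have hc := hP.card_eq t ht
  exact (hP.existsUnique_tile hc ((det_pos_iff a hc).1 (hP.det_pos t ht))).unique
    ⟨ht, rfl⟩ ⟨ht', h.symm⟩

lemma IsFineZonotopalTiling.sum_card_tilesOfOrder {a : Fin n → Fin d → ℝ}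
    {P : Finset (Tile n)} (hP : IsFineZonotopalTiling a P) :
    ∑ k ∈ Finset.range (n - d), (tilesOfOrder P k).card = P.card := by
  refine (Finset.card_eq_sum_card_fiberwise (f := fun t : Tile n => t.1.card) fun t ht => ?_).symm
  -- Disjointness gives `|I| + d + 1 ≤ n`, so every order is below `n - d`.
  have h := Finset.card_le_univ (t.1 ∪ t.2)
  rw [Finset.card_union_of_disjoint (hP.disjoint t ht), hP.card_eq t ht, Fintype.card_fin] at h
  simp only [Finset.coe_range, Set.mem_Iio]
  omega

end Tilings

end ZonotopalSplines

theorem corollary3 {n d : ℕ} (a : Fin n → Fin d → ℝ)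
    (ha : affineSpan ℝ (Set.range a) = ⊤)
    (P : Finset (ZonotopalSplines.Tile n)) (hP : ZonotopalSplines.IsFineZonotopalTiling a P)
    (T : Finset (Fin n) → Finset (Finset (Fin n))) (hT : ZonotopalSplines.Constructs a T P) :
    ∑ k ∈ Finset.range (n - d), Multiset.card (ZonotopalSplines.builtSplines a T k) =
      {B : Finset (Fin n) |
        B.card = d + 1 ∧ AffineIndependent ℝ (fun b : B => a b)}.ncard := by
  rw [← hP.card_eq_ncard, ← hP.sum_card_tilesOfOrder]
  refine Finset.sum_congr rfl fun k hk => ?_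
  rw [← hT.built k (Finset.mem_range.1 hk)]
  exact Multiset.card_map _ _
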